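/- **Setting.** Let $f:\operatorname{dom} f\subseteq\mathbb{R}^n\to\mathbb{R}$ be a $\nu$-self-concordant barrier with $\nu>0$. That is, $\operatorname{dom} f$ is open and convex; $f$ is convex, closed (closed epigraph) and $C^3$ on $\operatorname{dom} f$; for all $x\in\operatorname{dom} f$ and $v\in\mathbb{R}^n$ the function $\varphi(\tau)=f(x+\tau v)$ satisfies $|\varphi'''(\tau)|\le 2\varphi''(\tau)^{3/2}$ whenever $x+\tau v\in\operatorname{dom} f$; and $\sup_{u}\{2\nabla f(x)^Tu-u^T\nabla^2 f(x)u\}\le\nu$ for all $x\in\operatorname{dom} f$. Let $g:\mathbb{R}^n\to\mathbb{R}\cup\{+\infty\}$ be proper, lower semicontinuous and convex, and let $t>0$. Put $\operatorname{dom} F=\operatorname{dom} f\cap\operatorname{dom} g$ and $F(x;t)=f(x)+t^{-1}g(x)$. Let $x_t^*\in\operatorname{dom} F$ be a minimizer of $F(\cdot\,;t)$ with $\nabla^2 f(x_t^*)\succ 0$, and write $\|u\|_{x_t^*}=(u^T\nabla^2 f(x_t^*)u)^{1/2}$. For $z\in\operatorname{dom} F$ let $$\widehat F(x;t,z)=f(z)+\nabla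 f(z)^T(x-z)+\tfrac12(x-z)^T\nabla^2 f(z)(x-z)+t^{-1}g(x).$$ Let $x_t^0\in\operatorname{dom} F$, let $\delta_j\ge 0$ for $j\ge0$, and let $(x_t^j)_{j\ge 0}$ be inexact full-step proximal-Newton iterates: for every $j\ge 0$, $x_t^{j+1}\in\operatorname{dom} F$ is a $\delta_j$-solution of $\min_{x\in\operatorname{dom} F}\widehat F(x;t,x_t^j)$, i.e. $$\widehat F(x_t^{j+1};t,x_t^j)-\inf_{y\in\operatorname{dom} F}\widehat F(y;t,x_t^j)\le \delta_j^2/2 .$$ Put $\lambda_t^j=\|x_t^j-x_t^*\|_{x_t^*}$. **Corollary 3.3.** (a) There is an absolute constant $q\in[0,1)$ such that the following holds. If $\delta_j\le 0.15\,\lambda_t^j$ for all $j\ge0$ and $\lambda_t^0\le 0.1427$, then $x_t^j\to x_t^*$ at a linear rate in the local norm: $\lambda_t^j\to0$ and $\lambda_t^{j+1}\le q\,\lambda_t^j$ for all $j\ge 0$. (b) Let $c>0$. If $\delta_j\le c\,(\lambda_t^j)^2$ for all $j\ge0$ and $\lambda_t^0\le\min\{0.15,(1.177c+6.068)^{-1}\}$,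 then $x_t^j\to x_t^*$ at a quadratic rate in the local norm: $\lambda_t^j\to 0$ and $\lambda_t^{j+1}\le(1.177c+6.068)\,(\lambda_t^j)^2$ for all $j\ge 0$. -/

import Mathlib

namespace ProxNewton

/-- Standard self-concordance of a function of one real variable on the (open) set `I`:
convex, three times continuously differentiable, and `|φ'''| ≤ 2 (φ'')^(3/2)` on `I`. -/
structure IsStandardSelfConcordantOn (φ : ℝ → ℝ) (I : Set ℝ) : Prop where
  convexOn : ConvexOn ℝ I φ
  contDiffOn : ContDiffOn ℝ 3 φ I
  bound : ∀ τ ∈ I, |iteratedDeriv 3 φ τ| ≤ 2 * (iteratedDeriv 2 φ τ) ^ (3 / 2 : ℝ)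

/-- `f : D ⊆ ℝⁿ → ℝ`, with `D = dom f`, is (standard) self-concordant: `D` is open, `f` is a closed
convex `C³` function on `D`, and every restriction of `f` to a line is standard self-concordant.
The values of `f` outside `D` play no role (there `f = +∞`). -/
structure IsSelfConcordant {n : ℕ} (D : Set (EuclideanSpace ℝ (Fin n)))
    (f : EuclideanSpace ℝ (Fin n) → ℝ) : Prop where
  isOpen : IsOpen D
  convexOn : ConvexOn ℝ D f
  contDiffOn : ContDiffOn ℝ 3 f D
  /-- The epigraph of `f` is closed, i.e. `f`, extended by `+∞`, is lower semicontinuous. -/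
  closed_epigraph : IsClosed {p : EuclideanSpace ℝ (Fin n) × ℝ | p.1 ∈ D ∧ f p.1 ≤ p.2}
  line : ∀ x ∈ D, ∀ v : EuclideanSpace ℝ (Fin n),
    IsStandardSelfConcordantOn (fun τ : ℝ => f (x + τ • v)) {τ : ℝ | x + τ • v ∈ D}

/-- The Hessian of `f` at `x` as a bilinear form: `hess f x u v = uᵀ ∇²f(x) v`. -/
noncomputable def hess {n : ℕ} (f : EuclideanSpace ℝ (Fin n) → ℝ)
    (x : EuclideanSpace ℝ (Fin n)) :
    EuclideanSpace ℝ (Fin n) →L[ℝ] EuclideanSpace ℝ (Fin n) →L[ℝ] ℝ :=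
  fderiv ℝ (fderiv ℝ f) x

/-- The local norm `‖u‖_x = (uᵀ ∇²f(x) u)^(1/2)`. -/
noncomputable def localNorm {n : ℕ} (f : EuclideanSpace ℝ (Fin n) → ℝ)
    (x u : EuclideanSpace ℝ (Fin n)) : ℝ :=
  Real.sqrt (hess f x u u)

/-- `f`, with domain `D`, is a `ν`-self-concordant barrier for the closure of `D`:
it is self-concordant, `ν > 0`, and `sup_u {2 ∇f(x)ᵀu - ‖u‖_x²} ≤ ν` for every `x ∈ D`
(here `fderiv ℝ f x u` is `∇f(x)ᵀu`). -/
structure IsSelfConcordantBarrier {n : ℕ} (D : Set (EuclideanSpace ℝ (Fin n)))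
    (f : EuclideanSpace ℝ (Fin n) → ℝ) (ν : ℝ) : Prop where
  selfConcordant : IsSelfConcordant D f
  pos : 0 < ν
  bound : ∀ x ∈ D, ∀ u : EuclideanSpace ℝ (Fin n),
    2 * fderiv ℝ f x u - localNorm f x u ^ 2 ≤ ν

/-- `g : ℝⁿ → ℝ ∪ {+∞}` is proper, lower semicontinuous and convex (its epigraph is convex). -/
structure IsProperLscConvex {n : ℕ} (g : EuclideanSpace ℝ (Fin n) → EReal) : Prop where
  ne_bot : ∀ x, g x ≠ ⊥
  exists_ne_top : ∃ x, g x ≠ ⊤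
  lsc : LowerSemicontinuous g
  convex : Convex ℝ {p : EuclideanSpace ℝ (Fin n) × ℝ | g p.1 ≤ (p.2 : EReal)}

/-- `dom F = dom f ∩ dom g`, with `D = dom f` and `dom g = {x | g x < +∞}`. -/
def domF {n : ℕ} (D : Set (EuclideanSpace ℝ (Fin n)))
    (g : EuclideanSpace ℝ (Fin n) → EReal) : Set (EuclideanSpace ℝ (Fin n)) :=
  {x | x ∈ D ∧ g x < ⊤}

/-- The composite objective `F(x; t) = f(x) + t⁻¹ g(x)`. It is used only at points of `dom F`, where
`g` is finite; elsewhere the true value is `+∞`. -/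
noncomputable def F {n : ℕ} (f : EuclideanSpace ℝ (Fin n) → ℝ)
    (g : EuclideanSpace ℝ (Fin n) → EReal) (t : ℝ) (x : EuclideanSpace ℝ (Fin n)) : ℝ :=
  f x + t⁻¹ * (g x).toReal

/-- The second-order model `Q(x; z)` of `f` around `z`. -/
noncomputable def Q {n : ℕ} (f : EuclideanSpace ℝ (Fin n) → ℝ)
    (z x : EuclideanSpace ℝ (Fin n)) : ℝ :=
  f z + fderiv ℝ f z (x - z) + (1 / 2) * hess f z (x - z) (x - z)

/-- The composite quadratic model `F̂(x; t, z) = Q(x; z) + t⁻¹ g(x)`, used only on `dom F`. -/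
noncomputable def Fhat {n : ℕ} (f : EuclideanSpace ℝ (Fin n) → ℝ)
    (g : EuclideanSpace ℝ (Fin n) → EReal) (t : ℝ) (z x : EuclideanSpace ℝ (Fin n)) : ℝ :=
  Q f z x + t⁻¹ * (g x).toReal

/-- `x` is a solution of `min F(·; t)`; a solution lies in `dom F`. -/
def IsSolution {n : ℕ} (D : Set (EuclideanSpace ℝ (Fin n)))
    (f : EuclideanSpace ℝ (Fin n) → ℝ) (g : EuclideanSpace ℝ (Fin n) → EReal) (t : ℝ)
    (x : EuclideanSpace ℝ (Fin n)) : Prop :=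
  x ∈ domF D g ∧ IsMinOn (F f g t) (domF D g) x

/-- `x` is a `δ`-solution of the subproblem `min {F̂(y; t, z) | y ∈ dom F}`: it lies in `dom F` and
its model value exceeds the minimum of the model over `dom F` by at most `δ² / 2`. The existence of
an exact minimizer is not presupposed. -/
def IsDeltaSolution {n : ℕ} (D : Set (EuclideanSpace ℝ (Fin n)))
    (f : EuclideanSpace ℝ (Fin n) → ℝ) (g : EuclideanSpace ℝ (Fin n) → EReal) (t : ℝ)
    (z : EuclideanSpace ℝ (Fin n)) (δ : ℝ) (x : EuclideanSpace ℝ (Fin n)) : Prop :=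
  x ∈ domF D g ∧ ∀ y ∈ domF D g, Fhat f g t z x - Fhat f g t z y ≤ δ ^ 2 / 2

end ProxNewton

/-! Both rates come from one estimate, `localNorm_step_le`: with λ = ‖z − x*‖ < 1 in the local norm
at x*, every δ-solution x of the model at z satisfies ‖x − x*‖ ≤ λ²/(1−λ)⁴ + δ/(1−λ). For λ ≤ 0.15
this gives λ⁺ ≤ 1.98λ² + 1.177δ, and the corollary is then an induction on scalars.

For the estimate, the δ-optimality of x is tested only on the segment from x to x*, so no exact
minimizer of the model is needed. Convexity of g and the first-order condition at x* remove g. What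
remains is a quadratic in ‖d‖_z, d = x − x*, whose linear term is the error of linearizing ∇f
between x* and z. Optimizing along the segment gives ‖d‖_z ≤ λ²/(1−λ)³ + δ, and returning to the
norm at x* costs another factor 1/(1−λ).

The gradient error and the comparison of local norms follow from scalar differential inequalities
along the segment, driven by |D³f[u,v,v]| ≤ 2‖u‖‖v‖². Self-concordance supplies only u = v;
`abs_mixed_le` gives the mixed case. It is Banach's theorem that a symmetric form on a Euclidean
space attains its norm on the diagonal, proved here by an explicit cubature on the circle. -/

namespace ProxNewton

/-! ### Symmetric trilinear forms: from diagonal to mixed bounds. -/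

section Trilinear

variable {V : Type*} [NormedAddCommGroup V] [NormedSpace ℝ V]

theorem cubic_expand (T : V →L[ℝ] V →L[ℝ] V →L[ℝ] ℝ)
    (h₁ : ∀ u v w, T u v w = T v u w) (h₂ : ∀ u v w, T u v w = T u w v) (e₁ e₂ : V) (c s : ℝ) :
    T (c • e₁ + s • e₂) (c • e₁ + s • e₂) (c • e₁ + s • e₂) =
      c ^ 3 * T e₁ e₁ e₁ + 3 * c ^ 2 * s * T e₂ e₁ e₁ + 3 * c * s ^ 2 * T e₂ e₂ e₁
        + s ^ 3 * T e₂ e₂ e₂ := by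
  have a1 : T e₁ e₁ e₂ = T e₂ e₁ e₁ := by rw [h₂, h₁]
  have a2 : T e₁ e₂ e₁ = T e₂ e₁ e₁ := by rw [h₁]
  have a3 : T e₁ e₂ e₂ = T e₂ e₂ e₁ := by rw [h₁, h₂]
  have a4 : T e₂ e₁ e₂ = T e₂ e₂ e₁ := by rw [h₂]
  simp only [map_add, map_smul, add_apply, smul_apply,
    smul_eq_mul, a1, a2, a3, a4]
  ring

/-- A cubature identity for binary cubic forms on the circle: the mixed value at the angles
`3τ, 0, 0` is a convex combination of the diagonal values at `τ + 2πk/3`. -/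
theorem cubature_identity (c s r A B C E : ℝ) (hcs : c ^ 2 + s ^ 2 = 1) (hr : r ^ 2 = 3) :
    (4 * c ^ 3 - 3 * c) * A + (3 * s - 4 * s ^ 3) * B =
      (c ^ 2 - s ^ 2 / 3) ^ 2 * (c ^ 3 * A + 3 * c ^ 2 * s * B + 3 * c * s ^ 2 * C + s ^ 3 * E)
      + ((-c / 2 - r * s / 2) ^ 2 - (-s / 2 + r * c / 2) ^ 2 / 3) ^ 2 *
        ((-c / 2 - r * s / 2) ^ 3 * A
          + 3 * (-c / 2 - r * s / 2) ^ 2 * (-s / 2 + r * c / 2) * B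
          + 3 * (-c / 2 - r * s / 2) * (-s / 2 + r * c / 2) ^ 2 * C
          + (-s / 2 + r * c / 2) ^ 3 * E)
      + ((-c / 2 + r * s / 2) ^ 2 - (-s / 2 - r * c / 2) ^ 2 / 3) ^ 2 *
        ((-c / 2 + r * s / 2) ^ 3 * A
          + 3 * (-c / 2 + r * s / 2) ^ 2 * (-s / 2 - r * c / 2) * B
          + 3 * (-c / 2 + r * s / 2) * (-s / 2 - r * c / 2) ^ 2 * C
          + (-s / 2 - r * c / 2) ^ 3 * E) := by
  have h4 : r ^ 4 = 9 := by rw [show r ^ 4 = (r ^ 2) ^ 2 by ring, hr]; norm_num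
  have h6 : r ^ 6 = 27 := by rw [show r ^ 6 = (r ^ 2) ^ 3 by ring, hr]; norm_num
  -- The factor (c² + s²)² = 1 makes both sides homogeneous of degree 7 in (c, s), so that only r² =
  -- 3 is needed afterwards.
  have hl : (4 * c ^ 3 - 3 * c) * A + (3 * s - 4 * s ^ 3) * B =
      (c ^ 2 + s ^ 2) ^ 2 * ((c ^ 3 - 3 * c * s ^ 2) * A + (3 * c ^ 2 * s - s ^ 3) * B) := by
    rw [hcs]; linear_combination (3 * c * A - 3 * s * B) * hcs
  rw [hl]
  ring_nf
  simp only [hr, h4, h6]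
  ring

/-- At angle θ the weight is (1 + 2 cos 2θ)²/9 = (sin 3θ / (3 sin θ))², a Fejér kernel. Being
squares with sum one, the weights make the cubature a convex combination. -/
theorem cubature_weights (c s r : ℝ) (hcs : c ^ 2 + s ^ 2 = 1) (hr : r ^ 2 = 3) :
    (c ^ 2 - s ^ 2 / 3) ^ 2
      + ((-c / 2 - r * s / 2) ^ 2 - (-s / 2 + r * c / 2) ^ 2 / 3) ^ 2
      + ((-c / 2 + r * s / 2) ^ 2 - (-s / 2 - r * c / 2) ^ 2 / 3) ^ 2 = 1 := by
  have h4 : r ^ 4 = 9 := by rw [show r ^ 4 = (r ^ 2) ^ 2 by ring, hr]; norm_num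
  have hl : (1 : ℝ) = (c ^ 2 + s ^ 2) ^ 2 := by rw [hcs]; norm_num
  rw [hl]
  ring_nf
  simp only [hr, h4]
  ring

theorem abs_mixed_le_of_orthogonal (T : V →L[ℝ] V →L[ℝ] V →L[ℝ] ℝ)
    (h₁ : ∀ u v w, T u v w = T v u w) (h₂ : ∀ u v w, T u v w = T u w v)
    (B : V →L[ℝ] V →L[ℝ] ℝ) (hB : ∀ u v, B u v = B v u) {M : ℝ}
    (hT : ∀ w, B w w ≤ 1 → |T w w w| ≤ M) {e₁ e₂ : V} (he₁ : B e₁ e₁ ≤ 1) (he₂ : B e₂ e₂ ≤ 1)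
    (h12 : B e₁ e₂ = 0) {ρ σ : ℝ} (hρσ : ρ ^ 2 + σ ^ 2 = 1) :
    |T (ρ • e₁ + σ • e₂) e₁ e₁| ≤ M := by
  -- Trisect the angle of the unit vector (ρ, σ); the nodes are then τ, τ + 2π/3 and τ + 4π/3.
  obtain ⟨c, s, hcs, hc, hs⟩ : ∃ c s : ℝ, c ^ 2 + s ^ 2 = 1 ∧ 4 * c ^ 3 - 3 * c = ρ ∧
      3 * s - 4 * s ^ 3 = σ := by
    have hz : ‖(⟨ρ, σ⟩ : ℂ)‖ = 1 := by
      rw [Complex.norm_def, Complex.normSq_mk]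
      rw [show ρ * ρ + σ * σ = 1 by linarith, Real.sqrt_one]
    set z : ℂ := ⟨ρ, σ⟩ with hzdef
    have e := Complex.norm_mul_cos_arg z
    have e' := Complex.norm_mul_sin_arg z
    rw [hz, one_mul] at e e'
    refine ⟨Real.cos (z.arg / 3), Real.sin (z.arg / 3), Real.cos_sq_add_sin_sq _, ?_, ?_⟩
    · rw [← Real.cos_three_mul, mul_div_cancel₀ _ (by norm_num), e]
    · rw [← Real.sin_three_mul, mul_div_cancel₀ _ (by norm_num), e']
  obtain ⟨r, hr⟩ : ∃ r : ℝ, r ^ 2 = 3 := ⟨Real.sqrt 3, Real.sq_sqrt (by norm_num)⟩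
  have key : ∀ a b : ℝ, a ^ 2 + b ^ 2 = 1 → |a ^ 3 * T e₁ e₁ e₁ + 3 * a ^ 2 * b * T e₂ e₁ e₁
      + 3 * a * b ^ 2 * T e₂ e₂ e₁ + b ^ 3 * T e₂ e₂ e₂| ≤ M := by
    intro a b hab
    rw [← cubic_expand T h₁ h₂]
    apply hT
    have h21 : B e₂ e₁ = 0 := by rw [hB, h12]
    simp only [map_add, map_smul, add_apply, smul_apply,
      smul_eq_mul, h12, h21]
    nlinarith [mul_le_mul_of_nonneg_left he₁ (sq_nonneg a),
      mul_le_mul_of_nonneg_left he₂ (sq_nonneg b)]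
  have k0 := key c s hcs
  have k1 := key (-c / 2 - r * s / 2) (-s / 2 + r * c / 2)
    (by linear_combination (1 / 4 + r ^ 2 / 4) * hcs + hr / 4)
  have k2 := key (-c / 2 + r * s / 2) (-s / 2 - r * c / 2)
    (by linear_combination (1 / 4 + r ^ 2 / 4) * hcs + hr / 4)
  have w := cubature_weights c s r hcs hr
  have id := cubature_identity c s r (T e₁ e₁ e₁) (T e₂ e₁ e₁) (T e₂ e₂ e₁) (T e₂ e₂ e₂) hcs hr
  have hlin : T (ρ • e₁ + σ • e₂) e₁ e₁ = ρ * T e₁ e₁ e₁ + σ * T e₂ e₁ e₁ := by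
    simp only [map_add, map_smul, add_apply, smul_apply,
      smul_eq_mul]
  rw [hlin, ← hc, ← hs, id]
  generalize c ^ 3 * T e₁ e₁ e₁ + _ + _ + _ = X0 at *
  generalize (-c / 2 - r * s / 2) ^ 3 * T e₁ e₁ e₁ + _ + _ + _ = X1 at *
  generalize (-c / 2 + r * s / 2) ^ 3 * T e₁ e₁ e₁ + _ + _ + _ = X2 at *
  generalize c ^ 2 - s ^ 2 / 3 = w0 at *
  generalize (-c / 2 - r * s / 2) ^ 2 - _ = w1 at *
  generalize (-c / 2 + r * s / 2) ^ 2 - _ = w2 at *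
  calc |w0 ^ 2 * X0 + w1 ^ 2 * X1 + w2 ^ 2 * X2|
      ≤ |w0 ^ 2 * X0| + |w1 ^ 2 * X1| + |w2 ^ 2 * X2| := abs_add_three _ _ _
    _ = w0 ^ 2 * |X0| + w1 ^ 2 * |X1| + w2 ^ 2 * |X2| := by simp only [abs_mul, abs_sq]
    _ ≤ w0 ^ 2 * M + w1 ^ 2 * M + w2 ^ 2 * M := by gcongr
    _ = M := by rw [← add_mul, ← add_mul, w, one_mul]

/-- Gram–Schmidt writes u as ρv + σe₂ with e₂ orthogonal to v, so only the plane spanned by u and v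
matters. If u is a multiple of v, e₂ = 0 serves. -/
theorem abs_mixed_le_of_unit (T : V →L[ℝ] V →L[ℝ] V →L[ℝ] ℝ)
    (h₁ : ∀ u v w, T u v w = T v u w) (h₂ : ∀ u v w, T u v w = T u w v)
    (B : V →L[ℝ] V →L[ℝ] ℝ) (hB : ∀ u v, B u v = B v u) (hpos : ∀ u, u ≠ 0 → 0 < B u u) {M : ℝ}
    (hT : ∀ w, B w w ≤ 1 → |T w w w| ≤ M) {u v : V} (hu : B u u = 1) (hv : B v v = 1) :
    |T u v v| ≤ M := by
  have hnn : ∀ w, 0 ≤ B w w := fun w => by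
    by_cases h : w = 0
    · simp [h]
    · exact (hpos w h).le
  have hres : B (u - B v u • v) (u - B v u • v) = 1 - B v u ^ 2 := by
    simp only [map_sub, map_smul, sub_apply, smul_apply,
      smul_eq_mul, hu, hv, hB u v]
    ring
  have hρ : 0 ≤ 1 - B v u ^ 2 := hres ▸ hnn _
  have hsq := Real.sq_sqrt hρ
  set σ := Real.sqrt (1 - B v u ^ 2) with hσ
  by_cases h0 : σ = 0
  · have hz : u - B v u • v = 0 := by
      by_contra hne
      have := hpos _ hne
      rw [hres, ← hsq, h0] at this
      norm_num at this
    have := abs_mixed_le_of_orthogonal T h₁ h₂ B hB hT (e₁ := v) (e₂ := 0) hv.le (by simp) (by simp)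
      (ρ := B v u) (σ := σ) (by linarith)
    rwa [smul_zero, add_zero, ← sub_eq_zero.mp hz] at this
  · have := abs_mixed_le_of_orthogonal T h₁ h₂ B hB hT (e₁ := v) (e₂ := σ⁻¹ • (u - B v u • v)) hv.le
      (by
        simp only [map_smul, smul_apply, smul_eq_mul, hres, ← hsq]
        apply le_of_eq
        field_simp)
      (by simp [hv]) (ρ := B v u) (σ := σ) (by linarith)
    rwa [smul_smul, mul_inv_cancel₀ h0, one_smul, add_sub_cancel] at this

theorem abs_mixed_le_of_posDef (T : V →L[ℝ] V →L[ℝ] V →L[ℝ] ℝ)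
    (h₁ : ∀ u v w, T u v w = T v u w) (h₂ : ∀ u v w, T u v w = T u w v)
    (B : V →L[ℝ] V →L[ℝ] ℝ) (hB : ∀ u v, B u v = B v u) (hpos : ∀ u, u ≠ 0 → 0 < B u u)
    (hT : ∀ w, |T w w w| ≤ 2 * (B w w * Real.sqrt (B w w))) (u v : V) :
    |T u v v| ≤ 2 * Real.sqrt (B u u) * B v v := by
  by_cases hu : u = 0
  · simp [hu]
  by_cases hv : v = 0
  · simp [hv]
  have hnn : ∀ w, 0 ≤ B w w := fun w => by
    by_cases h : w = 0
    · simp [h]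
    · exact (hpos w h).le
  have hunit : ∀ w, w ≠ 0 → B ((Real.sqrt (B w w))⁻¹ • w) ((Real.sqrt (B w w))⁻¹ • w) = 1 := by
    intro w hw
    have h1 := Real.sqrt_pos.2 (hpos w hw)
    have h2 := Real.mul_self_sqrt (hnn w)
    simp only [map_smul, smul_apply, smul_eq_mul]
    rw [← mul_assoc, ← mul_inv, h2, inv_mul_cancel₀ (hpos w hw).ne']
  have := abs_mixed_le_of_unit T h₁ h₂ B hB hpos (M := 2) (fun w hw => (hT w).trans (by
    have : Real.sqrt (B w w) ≤ 1 := Real.sqrt_le_one.2 hw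
    nlinarith [mul_le_mul hw this (Real.sqrt_nonneg _) zero_le_one]))
    (hunit u hu) (hunit v hv)
  have hu1 := Real.sqrt_pos.2 (hpos u hu)
  have hv1 := Real.sqrt_pos.2 (hpos v hv)
  have hv2 := Real.mul_self_sqrt (hnn v)
  set a := Real.sqrt (B u u)
  set b := Real.sqrt (B v v)
  simp only [map_smul, smul_apply, smul_eq_mul, abs_mul,
    abs_of_pos (inv_pos.2 hu1), abs_of_pos (inv_pos.2 hv1)] at this
  calc |T u v v| = a * (b * b) * (b⁻¹ * (b⁻¹ * (a⁻¹ * |T u v v|))) := by field_simp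
    _ ≤ a * (b * b) * 2 := by gcongr
    _ = 2 * a * B v v := by rw [hv2]; ring

end Trilinear

/-- For a symmetric trilinear form, a bound on the diagonal by a Euclidean seminorm
bounds the mixed values with the same constant. -/
theorem abs_mixed_le {V : Type*} [NormedAddCommGroup V] [InnerProductSpace ℝ V]
    (T : V →L[ℝ] V →L[ℝ] V →L[ℝ] ℝ)
    (h₁ : ∀ u v w, T u v w = T v u w) (h₂ : ∀ u v w, T u v w = T u w v)
    (B : V →L[ℝ] V →L[ℝ] ℝ) (hB : ∀ u v, B u v = B v u) (hnn : ∀ u, 0 ≤ B u u)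
    (hT : ∀ w, |T w w w| ≤ 2 * (B w w * Real.sqrt (B w w))) (u v : V) :
    |T u v v| ≤ 2 * Real.sqrt (B u u) * B v v := by
  obtain ⟨E, hE⟩ : ∃ E : V →L[ℝ] V →L[ℝ] ℝ, ∀ a b, E a b = inner ℝ a b :=
    ⟨innerSL ℝ, fun _ _ => rfl⟩
  -- B may be degenerate. Adding ε times the inner product makes it definite and only weakens the
  -- diagonal bound; then ε → 0.
  have hε : ∀ ε : ℝ, 0 < ε → |T u v v| ≤
      2 * Real.sqrt (B u u + ε * inner ℝ u u) * (B v v + ε * inner ℝ v v) := by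
    intro ε hε
    have hval : ∀ a b, (B + ε • E) a b = B a b + ε * inner ℝ a b := fun a b => by simp [hE]
    rw [← hval, ← hval]
    refine abs_mixed_le_of_posDef T h₁ h₂ (B + ε • E) ?_ ?_ ?_ u v
    · intro a b
      rw [hval, hval, hB a b, real_inner_comm]
    · intro a ha
      have := real_inner_self_pos.2 ha
      rw [hval]
      exact add_pos_of_nonneg_of_pos (hnn a) (mul_pos hε this)
    · intro w
      have hle : B w w ≤ (B + ε • E) w w := by
        have : 0 ≤ ε * inner ℝ w w := mul_nonneg hε.le real_inner_self_nonneg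
        rw [hval]
        linarith
      refine (hT w).trans ?_
      have := hnn w
      have := this.trans hle
      gcongr
  have hlim : Filter.Tendsto (fun ε : ℝ =>
      2 * Real.sqrt (B u u + ε * inner ℝ u u) * (B v v + ε * inner ℝ v v))
      (nhdsWithin 0 (Set.Ioi 0)) (nhds (2 * Real.sqrt (B u u) * B v v)) := by
    have hc : Continuous (fun ε : ℝ =>
      2 * Real.sqrt (B u u + ε * inner ℝ u u) * (B v v + ε * inner ℝ v v)) := by fun_prop
    have := (hc.tendsto 0).mono_left (nhdsWithin_le_nhds (s := Set.Ioi 0))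
    simpa using this
  exact ge_of_tendsto hlim (Filter.eventually_of_mem self_mem_nhdsWithin hε)

/-! ### Scalar differential inequalities on [0, 1]. -/

/-- A nonnegative solution of `p' ≤ 2 p^(3/2)` blows up no earlier than its comparison solution. -/
theorem le_of_deriv_le_self_mul_sqrt {p p' : ℝ → ℝ} {l : ℝ} (hl0 : 0 < l) (hl1 : l < 1)
    (hp : ∀ τ ∈ Set.Icc (0 : ℝ) 1, HasDerivAt p (p' τ) τ)
    (hp' : ∀ τ ∈ Set.Icc (0 : ℝ) 1, |p' τ| ≤ 2 * Real.sqrt (p τ) * p τ) (h0 : p 0 = l ^ 2) :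
    ∀ τ ∈ Set.Icc (0 : ℝ) 1, p τ ≤ l ^ 2 / (1 - τ * l) ^ 2 := by
  intro τ hτ
  -- The comparison principle needs a strict inequality at contact points. The barrier l²/(1 − skl)²
  -- solves B' = 2k B^(3/2), strictly faster for k > 1; then k decreases to 1.
  have hε : ∀ k : ℝ, 1 < k → k * l < 1 → p τ ≤ l ^ 2 / (1 - τ * (k * l)) ^ 2 := by
    intro k hk hkl
    have hkl0 : 0 < k * l := by positivity
    have hden : ∀ s ∈ Set.Icc (0 : ℝ) 1, 0 < 1 - s * (k * l) := by
      intro s hs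
      nlinarith [hs.1, hs.2]
    have hB : ∀ s ∈ Set.Icc (0 : ℝ) 1, HasDerivAt (fun s => l ^ 2 / (1 - s * (k * l)) ^ 2)
        (2 * k * l ^ 3 / (1 - s * (k * l)) ^ 3) s := by
      intro s hs
      have hd := (hden s hs).ne'
      have h1 : HasDerivAt (fun s : ℝ => (1 - s * (k * l)) ^ 2)
          (2 * (1 - s * (k * l)) * -(k * l)) s := by
        have := (((hasDerivAt_id s).mul_const (k * l)).const_sub 1).fun_pow 2
        simpa using this
      refine ((hasDerivAt_const s (l ^ 2)).fun_div h1 (pow_ne_zero 2 hd)).congr_deriv ?_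
      field_simp
      ring
    refine image_le_of_deriv_right_lt_deriv_boundary'
      (f := p) (f' := p') (a := 0) (b := 1)
      (fun s hs => (hp s hs).continuousAt.continuousWithinAt)
      (fun s hs => (hp s ⟨hs.1, hs.2.le⟩).hasDerivWithinAt)
      (B := fun s => l ^ 2 / (1 - s * (k * l)) ^ 2)
      (B' := fun s => 2 * k * l ^ 3 / (1 - s * (k * l)) ^ 3)
      (by simp [h0])
      (fun s hs => (hB s hs).continuousAt.continuousWithinAt)
      (fun s hs => (hB s ⟨hs.1, hs.2.le⟩).hasDerivWithinAt) ?_ hτ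
    intro s hs heq
    have hs' : s ∈ Set.Icc (0 : ℝ) 1 := ⟨hs.1, hs.2.le⟩
    have hd := hden s hs'
    have hle := (le_abs_self _).trans (hp' s hs')
    refine hle.trans_lt ?_
    rw [heq, ← div_pow, Real.sqrt_sq (by positivity)]
    have : 2 * (l / (1 - s * (k * l))) * (l / (1 - s * (k * l))) ^ 2
        = 1 * (2 * l ^ 3 / (1 - s * (k * l)) ^ 3) := by field_simp
    rw [this, show 2 * k * l ^ 3 / (1 - s * (k * l)) ^ 3
      = k * (2 * l ^ 3 / (1 - s * (k * l)) ^ 3) by ring]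
    gcongr
  have hτl : 0 < 1 - τ * l := by nlinarith [hτ.1, hτ.2]
  have hlim : Filter.Tendsto (fun k : ℝ => l ^ 2 / (1 - τ * (k * l)) ^ 2)
      (nhdsWithin 1 (Set.Ioi 1)) (nhds (l ^ 2 / (1 - τ * l) ^ 2)) := by
    have hc : ContinuousAt (fun k : ℝ => l ^ 2 / (1 - τ * (k * l)) ^ 2) 1 := by
      refine ContinuousAt.div (by fun_prop) (by fun_prop) ?_
      rw [one_mul]
      positivity
    have := hc.tendsto.mono_left (nhdsWithin_le_nhds (s := Set.Ioi 1))
    simpa using this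
  refine ge_of_tendsto hlim ?_
  have h1 : ∀ᶠ k : ℝ in nhdsWithin 1 (Set.Ioi 1), k * l < 1 := by
    have hc : Continuous fun k : ℝ => k * l := by fun_prop
    exact ((hc.tendsto 1).mono_left nhdsWithin_le_nhds).eventually_lt_const (by simpa using hl1)
  filter_upwards [h1, self_mem_nhdsWithin] with k hk1 hk2
  exact hε k hk2 hk1

/-- Two-sided bound for a function with logarithmic derivative at most `2l / (1 - τl)`. -/
theorem bounds_of_abs_deriv_le {b b' : ℝ → ℝ} {l : ℝ} (hl0 : 0 ≤ l) (hl1 : l < 1)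
    (hb : ∀ τ ∈ Set.Icc (0 : ℝ) 1, HasDerivAt b (b' τ) τ)
    (hb' : ∀ τ ∈ Set.Icc (0 : ℝ) 1, |b' τ| ≤ 2 * (l / (1 - τ * l)) * b τ) :
    ∀ τ ∈ Set.Icc (0 : ℝ) 1,
      b τ * (1 - τ * l) ^ 2 ≤ b 0 ∧ b 0 * (1 - τ * l) ^ 2 ≤ b τ := by
  have hden : ∀ s ∈ Set.Icc (0 : ℝ) 1, 0 < 1 - s * l := by
    intro s hs
    nlinarith [hs.1, hs.2]
  have h1 : ∀ s : ℝ, HasDerivAt (fun s : ℝ => (1 - s * l) ^ 2) (2 * (1 - s * l) * -l) s := by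
    intro s
    have := (((hasDerivAt_id s).mul_const l).const_sub 1).fun_pow 2
    simpa using this
  have hanti : AntitoneOn (fun τ => b τ * (1 - τ * l) ^ 2) (Set.Icc 0 1) := by
    have hder : ∀ s ∈ Set.Icc (0 : ℝ) 1, HasDerivAt (fun τ => b τ * (1 - τ * l) ^ 2)
        (b' s * (1 - s * l) ^ 2 + b s * (2 * (1 - s * l) * -l)) s :=
      fun s hs => (hb s hs).fun_mul (h1 s)
    refine antitoneOn_of_deriv_nonpos (convex_Icc 0 1)
      (fun s hs => (hder s hs).continuousAt.continuousWithinAt)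
      (fun s hs => (hder s (interior_subset hs)).differentiableAt.differentiableWithinAt) ?_
    intro s hs
    have hs' := interior_subset hs
    rw [(hder s hs').deriv]
    have hd := hden s hs'
    have := mul_le_mul_of_nonneg_right ((le_abs_self _).trans (hb' s hs')) (sq_nonneg (1 - s * l))
    rw [show 2 * (l / (1 - s * l)) * b s * (1 - s * l) ^ 2 = 2 * l * b s * (1 - s * l) by
      field_simp] at this
    linarith
  have hmono : MonotoneOn (fun τ => b τ / (1 - τ * l) ^ 2) (Set.Icc 0 1) := by
    have hder : ∀ s ∈ Set.Icc (0 : ℝ) 1, HasDerivAt (fun τ => b τ / (1 - τ * l) ^ 2)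
        ((b' s * (1 - s * l) ^ 2 - b s * (2 * (1 - s * l) * -l)) / ((1 - s * l) ^ 2) ^ 2) s :=
      fun s hs => (hb s hs).fun_div (h1 s) (pow_ne_zero 2 (hden s hs).ne')
    refine monotoneOn_of_deriv_nonneg (convex_Icc 0 1)
      (fun s hs => (hder s hs).continuousAt.continuousWithinAt)
      (fun s hs => (hder s (interior_subset hs)).differentiableAt.differentiableWithinAt) ?_
    intro s hs
    have hs' := interior_subset hs
    rw [(hder s hs').deriv]
    have hd := hden s hs'
    have := mul_le_mul_of_nonneg_right ((neg_le_abs _).trans (hb' s hs')) (sq_nonneg (1 - s * l))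
    rw [show 2 * (l / (1 - s * l)) * b s * (1 - s * l) ^ 2 = 2 * l * b s * (1 - s * l) by
      field_simp] at this
    refine div_nonneg ?_ (by positivity)
    linarith
  intro τ hτ
  have h01 : (0 : ℝ) ∈ Set.Icc (0 : ℝ) 1 := by simp
  have e1 := hanti h01 hτ hτ.1
  have e2 := hmono h01 hτ hτ.1
  have hd := hden τ hτ
  simp only [zero_mul, sub_zero, one_pow, mul_one, div_one] at e1 e2
  exact ⟨e1, (le_div_iff₀ (by positivity)).1 e2⟩

/-- First-order Taylor remainder, expanded at the right endpoint `1` of `[0, 1]`. -/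
theorem abs_taylor_remainder_le {ψ ψ₁ ψ₂ : ℝ → ℝ} {l m : ℝ} (hl0 : 0 ≤ l) (hl1 : l < 1)
    (hψ : ∀ τ ∈ Set.Icc (0 : ℝ) 1, HasDerivAt ψ (ψ₁ τ) τ)
    (hψ₁ : ∀ τ ∈ Set.Icc (0 : ℝ) 1, HasDerivAt ψ₁ (ψ₂ τ) τ)
    (hbd : ∀ τ ∈ Set.Icc (0 : ℝ) 1, |ψ₂ τ| ≤ 2 * m / (1 - τ * l) ^ 3) :
    |ψ 1 - ψ 0 - ψ₁ 1| ≤ m / (1 - l) ^ 2 := by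
  have hden : ∀ s ∈ Set.Icc (0 : ℝ) 1, 0 < 1 - s * l := by
    intro s hs
    nlinarith [hs.1, hs.2]
  -- Multiplying ψ₁ by s cancels it in the derivative, leaving only −sψ₂, whose bound integrates
  -- exactly to ms²/(1 − sl)².
  have hΦ : ∀ s ∈ Set.Icc (0 : ℝ) 1,
      HasDerivAt (fun s => ψ s - ψ 0 - s * ψ₁ s) (-(s * ψ₂ s)) s := by
    intro s hs
    have := ((hψ s hs).sub_const (ψ 0)).fun_sub ((hasDerivAt_id' s).fun_mul (hψ₁ s hs))
    exact this.congr_deriv (by ring)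
  have hB : ∀ s ∈ Set.Icc (0 : ℝ) 1, HasDerivAt (fun s => m * s ^ 2 / (1 - s * l) ^ 2)
      (s * (2 * m / (1 - s * l) ^ 3)) s := by
    intro s hs
    have hd := (hden s hs).ne'
    have h1 : HasDerivAt (fun s : ℝ => (1 - s * l) ^ 2) (2 * (1 - s * l) * -l) s := by
      have := (((hasDerivAt_id s).mul_const l).const_sub 1).fun_pow 2
      simpa using this
    have h2 : HasDerivAt (fun s : ℝ => m * s ^ 2) (m * (2 * s)) s := by
      have := (((hasDerivAt_id s).fun_pow 2).const_mul m)
      simpa using this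
    refine (h2.fun_div h1 (pow_ne_zero 2 hd)).congr_deriv ?_
    field_simp
    ring
  have h := image_norm_le_of_norm_deriv_right_le_deriv_boundary'
    (f := fun s => ψ s - ψ 0 - s * ψ₁ s) (f' := fun s => -(s * ψ₂ s)) (a := 0) (b := 1)
    (fun s hs => (hΦ s hs).continuousAt.continuousWithinAt)
    (fun s hs => (hΦ s ⟨hs.1, hs.2.le⟩).hasDerivWithinAt)
    (B := fun s => m * s ^ 2 / (1 - s * l) ^ 2)
    (B' := fun s => s * (2 * m / (1 - s * l) ^ 3))
    (by simp)
    (fun s hs => (hB s hs).continuousAt.continuousWithinAt)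
    (fun s hs => (hB s ⟨hs.1, hs.2.le⟩).hasDerivWithinAt)
    (fun s hs => by
      rw [norm_neg, norm_mul, Real.norm_of_nonneg hs.1]
      exact mul_le_mul_of_nonneg_left (hbd s ⟨hs.1, hs.2.le⟩) hs.1)
    (Set.right_mem_Icc.2 zero_le_one)
  simpa using h

/-! ### Derivatives of a self-concordant function along segments. -/

section Derivatives

variable {n : ℕ} {D : Set (EuclideanSpace ℝ (Fin n))} {f : EuclideanSpace ℝ (Fin n) → ℝ}

theorem IsSelfConcordant.contDiffAt (hf : IsSelfConcordant D f) {x : EuclideanSpace ℝ (Fin n)}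
    (hx : x ∈ D) : ContDiffAt ℝ 3 f x :=
  hf.contDiffOn.contDiffAt (hf.isOpen.mem_nhds hx)

theorem IsSelfConcordant.contDiffAt_fderiv (hf : IsSelfConcordant D f)
    {x : EuclideanSpace ℝ (Fin n)} (hx : x ∈ D) : ContDiffAt ℝ 2 (fderiv ℝ f) x :=
  (hf.contDiffAt hx).fderiv_right (by norm_num)

theorem IsSelfConcordant.contDiffAt_hess (hf : IsSelfConcordant D f)
    {x : EuclideanSpace ℝ (Fin n)} (hx : x ∈ D) : ContDiffAt ℝ 1 (hess f) x :=
  (hf.contDiffAt_fderiv hx).fderiv_right (by norm_num)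

/-- The third derivative `third f x u v w = D³f(x)[u, v, w]`. -/
noncomputable def third (f : EuclideanSpace ℝ (Fin n) → ℝ) (x : EuclideanSpace ℝ (Fin n)) :
    EuclideanSpace ℝ (Fin n) →L[ℝ] EuclideanSpace ℝ (Fin n) →L[ℝ]
      EuclideanSpace ℝ (Fin n) →L[ℝ] ℝ :=
  fderiv ℝ (hess f) x

theorem hasDerivAt_line (x v : EuclideanSpace ℝ (Fin n)) (τ : ℝ) :
    HasDerivAt (fun τ : ℝ => x + τ • v) v τ := by
  simpa using ((hasDerivAt_id τ).smul_const v).const_add x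

theorem IsSelfConcordant.hasDerivAt_comp_line (hf : IsSelfConcordant D f)
    {x v : EuclideanSpace ℝ (Fin n)} {τ : ℝ} (hx : x + τ • v ∈ D) :
    HasDerivAt (fun τ : ℝ => f (x + τ • v)) (fderiv ℝ f (x + τ • v) v) τ :=
  ((hf.contDiffAt hx).differentiableAt (by norm_num)).hasFDerivAt.comp_hasDerivAt τ
    (hasDerivAt_line x v τ)

theorem IsSelfConcordant.hasDerivAt_fderiv_line (hf : IsSelfConcordant D f)
    {x v : EuclideanSpace ℝ (Fin n)} {τ : ℝ} (hx : x + τ • v ∈ D) (u : EuclideanSpace ℝ (Fin n)) :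
    HasDerivAt (fun τ : ℝ => fderiv ℝ f (x + τ • v) u) (hess f (x + τ • v) v u) τ := by
  have h := ((hf.contDiffAt_fderiv hx).differentiableAt (by norm_num)).hasFDerivAt.comp_hasDerivAt τ
    (hasDerivAt_line x v τ)
  exact ((ContinuousLinearMap.apply ℝ ℝ u).hasFDerivAt).comp_hasDerivAt τ h

theorem IsSelfConcordant.hasDerivAt_hess_line (hf : IsSelfConcordant D f)
    {x v : EuclideanSpace ℝ (Fin n)} {τ : ℝ} (hx : x + τ • v ∈ D)
    (u w : EuclideanSpace ℝ (Fin n)) :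
    HasDerivAt (fun τ : ℝ => hess f (x + τ • v) u w) (third f (x + τ • v) v u w) τ := by
  have h := ((hf.contDiffAt_hess hx).differentiableAt (by norm_num)).hasFDerivAt.comp_hasDerivAt τ
    (hasDerivAt_line x v τ)
  have h' := ((ContinuousLinearMap.apply ℝ (EuclideanSpace ℝ (Fin n) →L[ℝ] ℝ)
    u).hasFDerivAt).comp_hasDerivAt τ h
  exact ((ContinuousLinearMap.apply ℝ ℝ w).hasFDerivAt).comp_hasDerivAt τ h'

theorem IsSelfConcordant.hess_symm (hf : IsSelfConcordant D f) {x : EuclideanSpace ℝ (Fin n)}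
    (hx : x ∈ D) (u v : EuclideanSpace ℝ (Fin n)) : hess f x u v = hess f x v u :=
  (hf.contDiffAt hx).isSymmSndFDerivAt (by simp; norm_num) u v

theorem IsSelfConcordant.third_symm_left (hf : IsSelfConcordant D f)
    {x : EuclideanSpace ℝ (Fin n)} (hx : x ∈ D) (u v w : EuclideanSpace ℝ (Fin n)) :
    third f x u v w = third f x v u w :=
  congrArg (fun L => L w) ((hf.contDiffAt_fderiv hx).isSymmSndFDerivAt (by simp) u v)

theorem IsSelfConcordant.eventually_line_mem (hf : IsSelfConcordant D f)
    {x v : EuclideanSpace ℝ (Fin n)} {τ : ℝ} (hx : x + τ • v ∈ D) :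
    ∀ᶠ s : ℝ in nhds τ, x + s • v ∈ D :=
  (hasDerivAt_line x v τ).continuousAt.eventually_mem (hf.isOpen.mem_nhds hx)

/-- Hessian symmetry holds at all nearby points of the line, hence can be differentiated. -/
theorem IsSelfConcordant.third_symm_right (hf : IsSelfConcordant D f)
    {x : EuclideanSpace ℝ (Fin n)} (hx : x ∈ D) (u v w : EuclideanSpace ℝ (Fin n)) :
    third f x u v w = third f x u w v := by
  have hx0 : x + (0 : ℝ) • u ∈ D := by simpa using hx
  have h1 := hf.hasDerivAt_hess_line hx0 v w
  have h2 := hf.hasDerivAt_hess_line hx0 w v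
  have h3 := h2.congr_of_eventuallyEq ((hf.eventually_line_mem hx0).mono
    fun s hs => hf.hess_symm hs v w)
  simpa using h1.unique h3

theorem IsSelfConcordant.deriv_line_eventuallyEq (hf : IsSelfConcordant D f)
    {x v : EuclideanSpace ℝ (Fin n)} {τ : ℝ} (hx : x + τ • v ∈ D) :
    deriv (fun τ : ℝ => f (x + τ • v)) =ᶠ[nhds τ] fun s => fderiv ℝ f (x + s • v) v :=
  (hf.eventually_line_mem hx).mono fun _ hs => (hf.hasDerivAt_comp_line hs).deriv

theorem IsSelfConcordant.iteratedDeriv_two_line_eventuallyEq (hf : IsSelfConcordant D f)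
    {x v : EuclideanSpace ℝ (Fin n)} {τ : ℝ} (hx : x + τ • v ∈ D) :
    iteratedDeriv 2 (fun τ : ℝ => f (x + τ • v)) =ᶠ[nhds τ] fun s => hess f (x + s • v) v v := by
  filter_upwards [hf.eventually_line_mem hx] with s hs
  rw [iteratedDeriv_succ, iteratedDeriv_one, (hf.deriv_line_eventuallyEq hs).deriv_eq]
  exact (hf.hasDerivAt_fderiv_line hs v).deriv

theorem IsSelfConcordant.iteratedDeriv_three_line (hf : IsSelfConcordant D f)
    {x v : EuclideanSpace ℝ (Fin n)} {τ : ℝ} (hx : x + τ • v ∈ D) :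
    iteratedDeriv 3 (fun τ : ℝ => f (x + τ • v)) τ = third f (x + τ • v) v v v := by
  rw [iteratedDeriv_succ, (hf.iteratedDeriv_two_line_eventuallyEq hx).deriv_eq]
  exact (hf.hasDerivAt_hess_line hx v v).deriv

theorem IsSelfConcordant.hess_nonneg (hf : IsSelfConcordant D f)
    {x : EuclideanSpace ℝ (Fin n)} (hx : x ∈ D) (v : EuclideanSpace ℝ (Fin n)) :
    0 ≤ hess f x v v := by
  have hx0 : x + (0 : ℝ) • v ∈ D := by simpa using hx
  have hmono := (hf.line x hx v).convexOn.monotoneOn_deriv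
    fun τ hτ => (hf.hasDerivAt_comp_line hτ).differentiableAt
  have hopen : IsOpen {τ : ℝ | x + τ • v ∈ D} :=
    hf.isOpen.preimage (by fun_prop : Continuous fun τ : ℝ => x + τ • v)
  have h := hmono.derivWithin_nonneg (x := 0)
  rw [derivWithin_of_isOpen hopen hx0, (hf.deriv_line_eventuallyEq hx0).deriv_eq,
    (hf.hasDerivAt_fderiv_line hx0 v).deriv] at h
  simpa using h

theorem IsSelfConcordant.abs_third_diag_le (hf : IsSelfConcordant D f)
    {x : EuclideanSpace ℝ (Fin n)} (hx : x ∈ D) (v : EuclideanSpace ℝ (Fin n)) :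
    |third f x v v v| ≤ 2 * (hess f x v v * Real.sqrt (hess f x v v)) := by
  have hx0 : x + (0 : ℝ) • v ∈ D := by simpa using hx
  have h := (hf.line x hx v).bound 0 hx0
  rw [hf.iteratedDeriv_three_line hx0, (hf.iteratedDeriv_two_line_eventuallyEq hx0).eq_of_nhds] at h
  simp only [zero_smul, add_zero] at h
  refine h.trans_eq ?_
  have hn := hf.hess_nonneg hx v
  rw [Real.sqrt_eq_rpow, show (3 / 2 : ℝ) = 1 + 1 / 2 by norm_num,
    Real.rpow_add_of_nonneg hn zero_le_one (by norm_num), Real.rpow_one]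

theorem IsSelfConcordant.abs_third_le (hf : IsSelfConcordant D f)
    {x : EuclideanSpace ℝ (Fin n)} (hx : x ∈ D) (u v : EuclideanSpace ℝ (Fin n)) :
    |third f x u v v| ≤ 2 * localNorm f x u * hess f x v v :=
  abs_mixed_le (third f x) (hf.third_symm_left hx) (hf.third_symm_right hx) (hess f x)
    (hf.hess_symm hx) (hf.hess_nonneg hx) (hf.abs_third_diag_le hx) u v

theorem IsSelfConcordant.line_mem (hf : IsSelfConcordant D f) {x h : EuclideanSpace ℝ (Fin n)}
    (hx : x ∈ D) (hxh : x + h ∈ D) {τ : ℝ} (hτ : τ ∈ Set.Icc (0 : ℝ) 1) : x + τ • h ∈ D :=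
  hf.convexOn.1.add_smul_mem hx hxh hτ

theorem IsSelfConcordant.localNorm_sq (hf : IsSelfConcordant D f)
    {x : EuclideanSpace ℝ (Fin n)} (hx : x ∈ D) (v : EuclideanSpace ℝ (Fin n)) :
    localNorm f x v ^ 2 = hess f x v v :=
  Real.sq_sqrt (hf.hess_nonneg hx v)

theorem localNorm_nonneg (f : EuclideanSpace ℝ (Fin n) → ℝ) (x v : EuclideanSpace ℝ (Fin n)) :
    0 ≤ localNorm f x v :=
  Real.sqrt_nonneg _

/-- p(τ) = D²f(x + τh)[h, h] satisfies |p'| ≤ 2p^(3/2), so 1/√p decreases at rate at most one.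
Definiteness at x gives p(0) > 0 when h ≠ 0, as the comparison requires. -/
theorem IsSelfConcordant.localNorm_dir_le (hf : IsSelfConcordant D f)
    {x h : EuclideanSpace ℝ (Fin n)} (hx : x ∈ D) (hxh : x + h ∈ D)
    (hpos : ∀ u, u ≠ 0 → 0 < hess f x u u) (hl : localNorm f x h < 1) :
    ∀ τ ∈ Set.Icc (0 : ℝ) 1,
      localNorm f (x + τ • h) h ≤ localNorm f x h / (1 - τ * localNorm f x h) := by
  intro τ hτ
  by_cases h0 : h = 0
  · simp [h0, localNorm]
  have hl0 : 0 < localNorm f x h := Real.sqrt_pos.2 (hpos h h0)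
  have hd : 0 < 1 - τ * localNorm f x h := by nlinarith [hτ.1, hτ.2]
  have key := le_of_deriv_le_self_mul_sqrt (p := fun τ => hess f (x + τ • h) h h)
    (p' := fun τ => third f (x + τ • h) h h h) hl0 hl
    (fun s hs => hf.hasDerivAt_hess_line (hf.line_mem hx hxh hs) h h)
    (fun s hs => hf.abs_third_le (hf.line_mem hx hxh hs) h h)
    (by simp [hf.localNorm_sq hx]) τ hτ
  have := Real.sqrt_le_sqrt key
  rwa [← div_pow, Real.sqrt_sq (by positivity)] at this

/-- Comparison of the local norms along a segment. -/
theorem IsSelfConcordant.localNorm_compare (hf : IsSelfConcordant D f)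
    {x h : EuclideanSpace ℝ (Fin n)} (hx : x ∈ D) (hxh : x + h ∈ D)
    (hpos : ∀ u, u ≠ 0 → 0 < hess f x u u) (hl : localNorm f x h < 1)
    (d : EuclideanSpace ℝ (Fin n)) {τ : ℝ} (hτ : τ ∈ Set.Icc (0 : ℝ) 1) :
    localNorm f (x + τ • h) d * (1 - τ * localNorm f x h) ≤ localNorm f x d ∧
      localNorm f x d * (1 - τ * localNorm f x h) ≤ localNorm f (x + τ • h) d := by
  have hl0 := localNorm_nonneg f x h
  have hd : 0 < 1 - τ * localNorm f x h := by nlinarith [hτ.1, hτ.2]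
  have key := bounds_of_abs_deriv_le (b := fun τ => hess f (x + τ • h) d d)
    (b' := fun τ => third f (x + τ • h) h d d) hl0 hl
    (fun s hs => hf.hasDerivAt_hess_line (hf.line_mem hx hxh hs) d d)
    (fun s hs => by
      have hm := hf.line_mem hx hxh hs
      refine (hf.abs_third_le hm h d).trans ?_
      have := hf.hess_nonneg hm d
      gcongr
      exact hf.localNorm_dir_le hx hxh hpos hl s hs) τ hτ
  simp only [zero_smul, add_zero] at key
  rw [← hf.localNorm_sq hx, ← hf.localNorm_sq (hf.line_mem hx hxh hτ), ← mul_pow, ← mul_pow] at key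
  have a1 := localNorm_nonneg f x d
  have a2 := localNorm_nonneg f (x + τ • h) d
  exact ⟨(pow_le_pow_iff_left₀ (by positivity) a1 two_ne_zero).1 key.1,
    (pow_le_pow_iff_left₀ (by positivity) a2 two_ne_zero).1 key.2⟩

/-- The gradient linearization error, in the dual local norm at `x`. -/
theorem IsSelfConcordant.abs_gradient_error_le (hf : IsSelfConcordant D f)
    {x h : EuclideanSpace ℝ (Fin n)} (hx : x ∈ D) (hxh : x + h ∈ D)
    (hpos : ∀ u, u ≠ 0 → 0 < hess f x u u) (hl : localNorm f x h < 1)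
    (d : EuclideanSpace ℝ (Fin n)) :
    |fderiv ℝ f (x + h) d - fderiv ℝ f x d - hess f (x + h) h d| ≤
      localNorm f x h ^ 2 * localNorm f x d / (1 - localNorm f x h) ^ 2 := by
  have hl0 := localNorm_nonneg f x h
  have key := abs_taylor_remainder_le (ψ := fun τ => fderiv ℝ f (x + τ • h) d)
    (ψ₁ := fun τ => hess f (x + τ • h) h d) (ψ₂ := fun τ => third f (x + τ • h) h h d)
    (m := localNorm f x h ^ 2 * localNorm f x d) hl0 hl
    (fun s hs => hf.hasDerivAt_fderiv_line (hf.line_mem hx hxh hs) d)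
    (fun s hs => hf.hasDerivAt_hess_line (hf.line_mem hx hxh hs) h d)
    (fun s hs => by
      have hm := hf.line_mem hx hxh hs
      have hd : 0 < 1 - s * localNorm f x h := by nlinarith [hs.1, hs.2]
      -- Moving d to the first slot makes the repeated direction h the quadratic one, giving
      -- ‖d‖‖h‖².
      rw [hf.third_symm_right hm, hf.third_symm_left hm]
      refine (hf.abs_third_le hm d h).trans ?_
      rw [← hf.localNorm_sq hm]
      have h1 := hf.localNorm_dir_le hx hxh hpos hl s hs
      have h2 := (le_div_iff₀ hd).2 (hf.localNorm_compare hx hxh hpos hl d hs).1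
      have h3 := localNorm_nonneg f (x + s • h) h
      have h4 := localNorm_nonneg f x d
      calc 2 * localNorm f (x + s • h) d * localNorm f (x + s • h) h ^ 2
          ≤ 2 * (localNorm f x d / (1 - s * localNorm f x h)) *
            (localNorm f x h / (1 - s * localNorm f x h)) ^ 2 := by gcongr
        _ = 2 * (localNorm f x h ^ 2 * localNorm f x d) / (1 - s * localNorm f x h) ^ 3 := by
          field_simp)
  simpa using key

end Derivatives

/-! ### The one-step estimate. -/

section Step

variable {n : ℕ} {D : Set (EuclideanSpace ℝ (Fin n))} {f : EuclideanSpace ℝ (Fin n) → ℝ}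
  {g : EuclideanSpace ℝ (Fin n) → EReal} {t : ℝ}

theorem segment_mem_domF_and_le (hf : IsSelfConcordant D f) (hg : IsProperLscConvex g)
    {x y : EuclideanSpace ℝ (Fin n)} (hx : x ∈ domF D g) (hy : y ∈ domF D g) {s : ℝ}
    (hs : s ∈ Set.Icc (0 : ℝ) 1) :
    x + s • (y - x) ∈ domF D g ∧
      (g (x + s • (y - x))).toReal ≤ (g x).toReal + s * ((g y).toReal - (g x).toReal) := by
  have hconv := hg.convex (x := (x, (g x).toReal)) (y := (y, (g y).toReal))
    (by simp [EReal.coe_toReal hx.2.ne (hg.ne_bot x)])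
    (by simp [EReal.coe_toReal hy.2.ne (hg.ne_bot y)])
    (sub_nonneg.2 hs.2) hs.1 (by ring : 1 - s + s = 1)
  have hpt : (1 - s) • x + s • y = x + s • (y - x) := by module
  have hval : (1 - s) • (g x).toReal + s • (g y).toReal =
      (g x).toReal + s * ((g y).toReal - (g x).toReal) := by
    simp only [smul_eq_mul]
    ring
  simp only [Set.mem_ofPred_eq, Prod.smul_mk, Prod.mk_add_mk, hpt, hval] at hconv
  have htop := hconv.trans_lt (EReal.coe_lt_top _)
  refine ⟨⟨hf.convexOn.1.add_smul_sub_mem hx.1 hy.1 hs, htop⟩, ?_⟩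
  rw [← EReal.coe_toReal htop.ne (hg.ne_bot _)] at hconv
  exact EReal.coe_le_coe_iff.1 hconv

/-- First-order optimality of a minimizer of the composite objective. -/
theorem IsSolution.variational_inequality (hf : IsSelfConcordant D f) (hg : IsProperLscConvex g)
    (ht : 0 < t) {x y : EuclideanSpace ℝ (Fin n)} (hx : IsSolution D f g t x)
    (hy : y ∈ domF D g) :
    0 ≤ fderiv ℝ f x (y - x) + t⁻¹ * ((g y).toReal - (g x).toReal) := by
  have hx0 : x + (0 : ℝ) • (y - x) ∈ D := by simpa using hx.1.1
  have hder := ((hf.hasDerivAt_comp_line hx0).add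
    ((hasDerivAt_id (0 : ℝ)).mul_const (t⁻¹ * ((g y).toReal - (g x).toReal))))
  have hmin : ∀ s ∈ Set.Icc (0 : ℝ) 1, f x ≤
      f (x + s • (y - x)) + s * (t⁻¹ * ((g y).toReal - (g x).toReal)) := by
    intro s hs
    obtain ⟨hmem, hle⟩ := segment_mem_domF_and_le hf hg hx.1 hy hs
    have h1 : F f g t x ≤ F f g t (x + s • (y - x)) := hx.2 hmem
    have h2 := mul_le_mul_of_nonneg_left hle (inv_nonneg.2 ht.le)
    unfold F at h1
    linarith
  have hlim := hder.hasDerivWithinAt (s := Set.Ioi 0)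
  rw [hasDerivWithinAt_iff_tendsto_slope' (by simp)] at hlim
  have hev : ∀ᶠ s : ℝ in nhdsWithin 0 (Set.Ioi 0), s < 1 :=
    nhdsWithin_le_nhds (eventually_lt_nhds one_pos)
  have := ge_of_tendsto hlim (b := 0) (by
    filter_upwards [hev, self_mem_nhdsWithin] with s hs1 hs0
    have hs0' : 0 < s := hs0
    have := hmin s ⟨hs0'.le, hs1.le⟩
    rw [slope_def_field]
    refine div_nonneg ?_ (by linarith)
    simp only [Pi.add_apply, id, zero_smul, add_zero, zero_mul]
    linarith)
  simpa using this

/-- For a > R the left side is maximal in s at s = (a − R)/a, with value (a − R)². In the step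
estimate, s parametrizes the segment from the new iterate to x*. -/
theorem le_add_of_quadratic_test {a R δ : ℝ} (hR : 0 ≤ R) (hδ : 0 ≤ δ)
    (h : ∀ s ∈ Set.Icc (0 : ℝ) 1, s * (2 - s) * a ^ 2 - 2 * s * R * a ≤ δ ^ 2) : a ≤ R + δ := by
  by_cases ha : a ≤ R
  · linarith
  have ha0 : 0 < a := by linarith
  have := h ((a - R) / a) ⟨div_nonneg (by linarith) ha0.le, (div_le_one ha0).2 (by linarith)⟩
  have e : (a - R) / a * (2 - (a - R) / a) * a ^ 2 - 2 * ((a - R) / a) * R * a = (a - R) ^ 2 := by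
    field_simp
    ring
  rw [e] at this
  have := abs_le_of_sq_le_sq this hδ
  linarith [le_abs_self (a - R)]

/-- One inexact full proximal-Newton step. -/
theorem localNorm_step_le (hf : IsSelfConcordant D f) (hg : IsProperLscConvex g) (ht : 0 < t)
    {xstar z x : EuclideanSpace ℝ (Fin n)} {δ : ℝ} (hstar : IsSolution D f g t xstar)
    (hpos : ∀ u, u ≠ 0 → 0 < hess f xstar u u) (hz : z ∈ domF D g) (hδ : 0 ≤ δ)
    (hx : IsDeltaSolution D f g t z δ x) (hl : localNorm f xstar (z - xstar) < 1) :
    localNorm f xstar (x - xstar) ≤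
      localNorm f xstar (z - xstar) ^ 2 / (1 - localNorm f xstar (z - xstar)) ^ 4 +
        δ / (1 - localNorm f xstar (z - xstar)) := by
  obtain ⟨h, rfl⟩ : ∃ h, z = xstar + h := ⟨z - xstar, by abel⟩
  obtain ⟨d, rfl⟩ : ∃ d, x = xstar + d := ⟨x - xstar, by abel⟩
  simp only [add_sub_cancel_left] at hl ⊢
  have hxs := hstar.1.1
  have herr := hf.abs_gradient_error_le hxs hz.1 hpos hl d
  have hcmp := (hf.localNorm_compare hxs hz.1 hpos hl d (τ := 1) (by simp)).2
  simp only [one_mul, one_smul] at hcmp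
  have hl0 := localNorm_nonneg f xstar h
  have ha0 := localNorm_nonneg f (xstar + h) d
  have hsq := hf.localNorm_sq hz.1 d
  have hsymm := hf.hess_symm hz.1 h d
  have hvar := hstar.variational_inequality hf hg ht hx.1
  have hconv := fun s hs => segment_mem_domF_and_le hf hg hx.1 hstar.1 (s := s) hs
  have hdel := hx.2
  simp only [add_sub_cancel_left] at hvar
  generalize localNorm f xstar h = l at *
  have hl1 : 0 < 1 - l := by linarith
  have hcmp' := (le_div_iff₀ hl1).2 hcmp
  have herr' : |fderiv ℝ f (xstar + h) d - fderiv ℝ f xstar d - hess f (xstar + h) h d| ≤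
      l ^ 2 / (1 - l) ^ 3 * localNorm f (xstar + h) d := by
    refine herr.trans ?_
    calc l ^ 2 * localNorm f xstar d / (1 - l) ^ 2
        ≤ l ^ 2 * (localNorm f (xstar + h) d / (1 - l)) / (1 - l) ^ 2 := by gcongr
      _ = l ^ 2 / (1 - l) ^ 3 * localNorm f (xstar + h) d := by field_simp
  have hmain : localNorm f (xstar + h) d ≤ l ^ 2 / (1 - l) ^ 3 + δ := by
    refine le_add_of_quadratic_test (by positivity) hδ ?_
    intro s hs
    -- At the test point x + s(x* − x), the Hessian terms contribute s(2 − s)‖d‖²/2 − sD²f(z)[h, d].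
    -- The inequality for g and `hvar` replace the g terms by −s∇f(x*)ᵀd, and `herr'` bounds the
    -- resulting linear term.
    obtain ⟨hmem, hgle⟩ := hconv s hs
    have h1 := hdel _ hmem
    have h2 := mul_le_mul_of_nonneg_left hgle (inv_nonneg.2 ht.le)
    have e1 : xstar + d + s • (xstar - (xstar + d)) - (xstar + h) = (1 - s) • d - h := by module
    have e2 : xstar + d - (xstar + h) = d - h := by abel
    unfold Fhat Q at h1
    rw [e1, e2] at h1
    simp only [map_sub, map_smul, sub_apply, smul_apply, smul_eq_mul, hsymm] at h1
    rw [hsq]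
    have h3 := mul_le_mul_of_nonneg_left ((neg_le_abs _).trans herr') hs.1
    have h4 := mul_le_mul_of_nonneg_left hvar hs.1
    rw [hsymm] at h3
    nlinarith
  calc localNorm f xstar d ≤ localNorm f (xstar + h) d / (1 - l) := hcmp'
    _ ≤ (l ^ 2 / (1 - l) ^ 3 + δ) / (1 - l) := by gcongr
    _ = l ^ 2 / (1 - l) ^ 4 + δ / (1 - l) := by field_simp

end Step

/-! ### Convergence of the iterates from decay of the local norm. -/

theorem tendsto_zero_of_le_mul {lam : ℕ → ℝ} {q : ℝ} (h0 : ∀ j, 0 ≤ lam j) (hq0 : 0 ≤ q)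
    (hq1 : q < 1) (h : ∀ j, lam (j + 1) ≤ q * lam j) :
    Filter.Tendsto lam Filter.atTop (nhds 0) := by
  have hle : ∀ j, lam j ≤ lam 0 * q ^ j := by
    intro j
    induction j with
    | zero => simp
    | succ k ih =>
      calc lam (k + 1) ≤ q * lam k := h k
        _ ≤ q * (lam 0 * q ^ k) := by gcongr
        _ = lam 0 * q ^ (k + 1) := by ring
  refine squeeze_zero h0 hle ?_
  simpa using (tendsto_pow_atTop_nhds_zero_of_lt_one hq0 hq1).const_mul (lam 0)

/-- A positive definite form on a finite-dimensional space dominates the squared norm. -/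
theorem exists_pos_mul_norm_sq_le {n : ℕ}
    (B : EuclideanSpace ℝ (Fin n) →L[ℝ] EuclideanSpace ℝ (Fin n) →L[ℝ] ℝ)
    (hpos : ∀ u, u ≠ 0 → 0 < B u u) : ∃ m : ℝ, 0 < m ∧ ∀ u, m * ‖u‖ ^ 2 ≤ B u u := by
  by_cases hne : (Metric.sphere (0 : EuclideanSpace ℝ (Fin n)) 1).Nonempty
  · obtain ⟨w, hw, hmin⟩ := (isCompact_sphere (0 : EuclideanSpace ℝ (Fin n)) 1).exists_isMinOn hne
      (f := fun u => B u u) (by fun_prop)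
    have hw0 : w ≠ 0 := by
      rintro rfl
      simp at hw
    refine ⟨B w w, hpos w hw0, fun u => ?_⟩
    by_cases hu : u = 0
    · simp [hu]
    have hu' := norm_pos_iff.2 hu
    have hmem : ‖u‖⁻¹ • u ∈ Metric.sphere (0 : EuclideanSpace ℝ (Fin n)) 1 := by
      simp [norm_smul, hu'.ne']
    have h : B w w ≤ B (‖u‖⁻¹ • u) (‖u‖⁻¹ • u) := hmin hmem
    simp only [map_smul, smul_apply, smul_eq_mul] at h
    calc B w w * ‖u‖ ^ 2 ≤ ‖u‖⁻¹ * (‖u‖⁻¹ * B u u) * ‖u‖ ^ 2 := by gcongr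
      _ = B u u := by field_simp
  -- The unit sphere is empty only in the zero space, where any constant works.
  · refine ⟨1, one_pos, fun u => ?_⟩
    by_cases hu : u = 0
    · simp [hu]
    · exact absurd ⟨‖u‖⁻¹ • u, by simp [norm_smul, hu]⟩ hne

theorem tendsto_of_localNorm_tendsto_zero {n : ℕ} {f : EuclideanSpace ℝ (Fin n) → ℝ}
    {xstar : EuclideanSpace ℝ (Fin n)} {x : ℕ → EuclideanSpace ℝ (Fin n)}
    (hpos : ∀ u, u ≠ 0 → 0 < hess f xstar u u)
    (h : Filter.Tendsto (fun j => localNorm f xstar (x j - xstar)) Filter.atTop (nhds 0)) :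
    Filter.Tendsto x Filter.atTop (nhds xstar) := by
  obtain ⟨m, hm, hle⟩ := exists_pos_mul_norm_sq_le (hess f xstar) hpos
  rw [tendsto_iff_norm_sub_tendsto_zero]
  have h' : Filter.Tendsto (fun j => (Real.sqrt m)⁻¹ * localNorm f xstar (x j - xstar))
      Filter.atTop (nhds 0) := by
    simpa using h.const_mul (Real.sqrt m)⁻¹
  refine squeeze_zero (fun _ => norm_nonneg _) (fun j => ?_) h'
  have hs := Real.sqrt_le_sqrt (hle (x j - xstar))
  rw [Real.sqrt_mul hm.le, Real.sqrt_sq (norm_nonneg _)] at hs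
  rw [inv_mul_eq_div, le_div_iff₀ (Real.sqrt_pos.2 hm), mul_comm]
  exact hs

end ProxNewton

/-! ### The two rates. -/

theorem corollary3p3 :
    ∃ q : ℝ, 0 ≤ q ∧ q < 1 ∧
      ∀ (n : ℕ) (D : Set (EuclideanSpace ℝ (Fin n))) (f : EuclideanSpace ℝ (Fin n) → ℝ)
        (ν : ℝ) (g : EuclideanSpace ℝ (Fin n) → EReal) (t : ℝ)
        (xstar : EuclideanSpace ℝ (Fin n)) (x : ℕ → EuclideanSpace ℝ (Fin n)) (δ lam : ℕ → ℝ),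
        ProxNewton.IsSelfConcordantBarrier D f ν →
        ProxNewton.IsProperLscConvex g →
        0 < t →
        ProxNewton.IsSolution D f g t xstar →
        (∀ u : EuclideanSpace ℝ (Fin n), u ≠ 0 → 0 < ProxNewton.hess f xstar u u) →
        x 0 ∈ ProxNewton.domF D g →
        (∀ j, 0 ≤ δ j) →
        (∀ j, ProxNewton.IsDeltaSolution D f g t (x j) (δ j) (x (j + 1))) →
        (∀ j, lam j = ProxNewton.localNorm f xstar (x j - xstar)) →
        (((∀ j, δ j ≤ 0.15 * lam j) → lam 0 ≤ 0.1427 →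
            Filter.Tendsto x Filter.atTop (nhds xstar) ∧
            Filter.Tendsto lam Filter.atTop (nhds 0) ∧
            ∀ j, lam (j + 1) ≤ q * lam j) ∧
          (∀ c : ℝ, 0 < c → (∀ j, δ j ≤ c * lam j ^ 2) →
            lam 0 ≤ min 0.15 (1.177 * c + 6.068)⁻¹ →
            Filter.Tendsto x Filter.atTop (nhds xstar) ∧
            Filter.Tendsto lam Filter.atTop (nhds 0) ∧
            ∀ j, lam (j + 1) ≤ (1.177 * c + 6.068) * lam j ^ 2)) := by
  refine ⟨1 / 2, by norm_num, by norm_num, ?_⟩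
  intro n D f ν g t xstar x δ lam hf hg ht hstar hpos hx0 hδ hstep hlam
  have hmem : ∀ j, x j ∈ ProxNewton.domF D g := fun j => by
    cases j with
    | zero => exact hx0
    | succ k => exact (hstep k).1
  have hl0 : ∀ j, 0 ≤ lam j := fun j => by
    rw [hlam]
    exact ProxNewton.localNorm_nonneg _ _ _
  -- The constants `1.98` and `1.177` bound `(1 - λ)⁻⁴` and `(1 - λ)⁻¹` for `λ ≤ 0.15`.
  have hrec : ∀ j, lam j ≤ 0.15 → lam (j + 1) ≤ 1.98 * lam j ^ 2 + 1.177 * δ j := by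
    intro j hj
    have h := ProxNewton.localNorm_step_le hf.selfConcordant hg ht hstar hpos (hmem j) (hδ j)
      (hstep j) (by rw [← hlam]; linarith)
    rw [← hlam, ← hlam] at h
    have hb : (0.85 : ℝ) ≤ 1 - lam j := by linarith
    refine h.trans (add_le_add ?_ ?_)
    · calc lam j ^ 2 / (1 - lam j) ^ 4 ≤ lam j ^ 2 / 0.85 ^ 4 := by gcongr
        _ ≤ 1.98 * lam j ^ 2 := by
          rw [div_le_iff₀ (by norm_num)]
          nlinarith [sq_nonneg (lam j)]
    · calc δ j / (1 - lam j) ≤ δ j / 0.85 := by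
            have := hδ j
            gcongr
        _ ≤ 1.177 * δ j := by
          rw [div_le_iff₀ (by norm_num)]
          nlinarith [hδ j]
  have hx_tendsto : Filter.Tendsto lam Filter.atTop (nhds 0) →
      Filter.Tendsto x Filter.atTop (nhds xstar) := fun h =>
    ProxNewton.tendsto_of_localNorm_tendsto_zero hpos (by simpa only [← hlam] using h)
  constructor
  · intro hδl hl
    -- Here 0.15 · (1.98 + 1.177) < 0.474, which justifies q = 1/2; the contraction also keeps the
    -- iterates in the region λ ≤ 0.15.
    have hind : ∀ j, lam j ≤ 0.15 → lam (j + 1) ≤ 1 / 2 * lam j := by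
      intro j hj
      nlinarith [hrec j hj, hδl j, hl0 j, mul_le_mul_of_nonneg_right hj (hl0 j)]
    have hbd : ∀ j, lam j ≤ 0.15 := by
      intro j
      induction j with
      | zero => linarith
      | succ k ih => linarith [hind k ih, hl0 k]
    have hlin := fun j => hind j (hbd j)
    have hlim := ProxNewton.tendsto_zero_of_le_mul hl0 (by norm_num) (by norm_num) hlin
    exact ⟨hx_tendsto hlim, hlim, hlin⟩
  · intro c hc hδl hl
    have hK : 0 < 1.177 * c + 6.068 := by linarith
    have hquad : ∀ j, lam j ≤ 0.15 → lam (j + 1) ≤ (1.177 * c + 1.98) * lam j ^ 2 := by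
      intro j hj
      linarith [hrec j hj, hδl j]
    -- With the stated coefficient alone, the endpoint λ = (1.177c + 6.068)⁻¹ would give no
    -- decrease. The slack between 1.98 and 6.068 provides a contraction factor ρ < 1, depending on
    -- c.
    set ρ : ℝ := (1.177 * c + 1.98) / (1.177 * c + 6.068) with hρ
    have hρ0 : 0 ≤ ρ := by positivity
    have hρ1 : ρ < 1 := (div_lt_one hK).2 (by linarith)
    have hind : ∀ j, lam j ≤ min 0.15 (1.177 * c + 6.068)⁻¹ → lam (j + 1) ≤ ρ * lam j := by
      intro j hj
      obtain ⟨h1, h2⟩ := le_min_iff.1 hj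
      have := hl0 j
      calc lam (j + 1) ≤ (1.177 * c + 1.98) * lam j ^ 2 := hquad j h1
        _ = (1.177 * c + 1.98) * lam j * lam j := by ring
        _ ≤ (1.177 * c + 1.98) * (1.177 * c + 6.068)⁻¹ * lam j := by gcongr
        _ = ρ * lam j := by rw [hρ, div_eq_mul_inv]
    have hbd : ∀ j, lam j ≤ min 0.15 (1.177 * c + 6.068)⁻¹ := by
      intro j
      induction j with
      | zero => exact hl
      | succ k ih =>
        exact (hind k ih).trans ((mul_le_of_le_one_left (hl0 k) hρ1.le).trans ih)
    have hlim := ProxNewton.tendsto_zero_of_le_mul hl0 hρ0 hρ1 fun j => hind j (hbd j)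
    refine ⟨hx_tendsto hlim, hlim, fun j => ?_⟩
    refine (hquad j ((hbd j).trans (min_le_left _ _))).trans ?_
    have := sq_nonneg (lam j)
    gcongr
    norm_num
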